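/- Let $N\ge 3$ be an integer and let $q\in\mathbb C$ be nonzero and not a root of unity. Let $P=\mathbb Z\epsilon_1\oplus\cdots\oplus\mathbb Z\epsilon_N$ with the bilinear form $(\epsilon_i,\epsilon_j)=\delta_{ij}$, and let $Q\subset P$ be the subgroup generated by $\epsilon_i-\epsilon_{i+1}$, $1\le i\le N-1$. Let $\varepsilon:Q\times Q\to\{\pm1\}$ be any bimultiplicative function with $\varepsilon(\alpha,\alpha)=(-1)^{(\alpha,\alpha)/2}$ for all $\alpha\in Q$. Let $\mathbb C[Q]$ be the group algebra of $Q$, with basis $e^\alpha$ ($\alpha\in Q$), and for $\beta\in Q$, $\lambda\in P$ define operators on $\mathbb C[Q]$ by $$e_\beta e^\alpha=\varepsilon(\beta,\alpha)e^{\alpha+\beta},\qquad z^{\beta}e^\alpha=z^{(\beta,\alpha)}e^\alpha,\qquad q^{\lambda}e^\alpha=q^{(\lambda,\alpha)}e^\alpha .$$ Let $S(\mathcal H^-)=\mathbb C[\epsilon_i(-n):1\le i\le N,\ n\ge1]$ be the polynomial algebra, on which, for $n\ge 1$, $\epsilon_i(-n)$ acts by multiplication and $\epsilon_i(n)$ acts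 as $n\,\partial/\partial\epsilon_i(-n)$, so that $[\epsilon_i(m),\epsilon_j(n)]=m\,\delta_{ij}\delta_{m+n,0}$ for nonzero integers $m,n$. Put $V_Q=S(\mathcal H^-)\otimes\mathbb C[Q]$. For $1\le i\ne j\le N$ define the vertex operator $$X_{ij}(z)=\exp\Big(\sum_{n\ge1}\frac{\epsilon_i(-n)-q^{(i-j)n}\epsilon_j(-n)}{n}z^{n}\Big)\exp\Big(-\sum_{n\ge1}\frac{\epsilon_i(n)-q^{(i-j)n}\epsilon_j(n)}{n}z^{-n}\Big)\,e_{\epsilon_i-\epsilon_j}\,z^{\epsilon_i-\epsilon_j+1},$$ whose coefficients of $z^m$ ($m\in\mathbb Z$) are operators on $V_Q$, and put $E_i(z)=X_{i,i+1}(z)$, $F_i(z)=X_{i+1,i}(z)$ for $1\le i\le N-1$. Let $\mathcal B$ be the unital associative algebra of operators on $V_Q$ generated by all coefficients of $E_i(z)$ and $F_i(z)$ for $1\le i\le N-1$, by $\epsilon_i(n)$ for $1\le i\le N$, $n\in\mathbb Z\setminus\{0\}$, and by $q^{\pm\epsilon_i}$ for $1\le i\le N$. Then $V_Q$ is an irreducible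 $\mathcal B$-module. -/

import Mathlib

open scoped TensorProduct Nat

noncomputable section

namespace FockRep

/-! ### Lattices -/

/-- The vector `ε_i` of the lattice `P = ℤε_1 ⊕ ⋯ ⊕ ℤε_N`, modelled as `Fin N → ℤ`; the bilinear
form with `(ε_i, ε_j) = δ_ij` is `dotProduct`. The index `i : Fin N` stands for `i + 1` in `1..N`. -/
def eps {N : ℕ} (i : Fin N) : Fin N → ℤ := Pi.single i 1

/-- The root lattice `Q` of type `A_{N-1}`: the span of the `ε_i - ε_{i+1}` in `P`. -/
def rootLattice (N : ℕ) : AddSubgroup (Fin N → ℤ) :=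
  AddSubgroup.closure {x | ∃ i j : Fin N, (j : ℕ) = i + 1 ∧ x = eps i - eps j}

lemma eps_sub_eps_mem_aux {N : ℕ} (k : ℕ) :
    ∀ i j : Fin N, (j : ℕ) = i + k → eps i - eps j ∈ rootLattice N := by
  induction k with
  | zero =>
    intro i j h
    have : i = j := by ext; omega
    subst this
    simp
  | succ k ih =>
    intro i j h
    have hlt : (i : ℕ) + k < N := by have := j.isLt; omega
    have h1 := ih i ⟨i + k, hlt⟩ rfl
    have h2 : eps (⟨i + k, hlt⟩ : Fin N) - eps j ∈ rootLattice N :=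
      AddSubgroup.subset_closure ⟨⟨i + k, hlt⟩, j, by simp only; omega, rfl⟩
    have := add_mem h1 h2
    simpa using this

lemma eps_sub_eps_mem {N : ℕ} (i j : Fin N) : eps i - eps j ∈ rootLattice N := by
  rcases le_total (i : ℕ) j with h | h
  · exact eps_sub_eps_mem_aux (j - i) i j (by omega)
  · have := neg_mem (eps_sub_eps_mem_aux (i - j) j i (by omega))
    simpa using this

/-- The element `ε_i - ε_j` of `Q`. -/
def root {N : ℕ} (i j : Fin N) : rootLattice N := ⟨eps i - eps j, eps_sub_eps_mem i j⟩

/-- `c : Q × Q → {±1}` is bimultiplicative with `c(α, α) = (-1)^{(α, α)/2}`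
(note that `(α, α)` is even for every `α ∈ Q`). -/
structure IsSignCocycle {N : ℕ} (c : rootLattice N → rootLattice N → ℤˣ) : Prop where
  add_left : ∀ α β γ, c (α + β) γ = c α γ * c β γ
  add_right : ∀ α β γ, c α (β + γ) = c α β * c α γ
  self : ∀ α : rootLattice N, c α α = (-1 : ℤˣ) ^ (dotProduct α.1 α.1 / 2)

/-! ### The Heisenberg algebra on its Fock space -/

/-- `S(H⁻)`: the variable `(i, n)` is `ε_i(-n)`, for `n ≥ 1`. -/
abbrev Fock (N : ℕ) : Type := MvPolynomial (Fin N × ℕ+) ℂ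

/-- The action of `ε_i(n)` on `S(H⁻)`: multiplication by the variable `ε_i(n)` if `n < 0`, and
`n ∂/∂ε_i(-n)` if `n > 0`, so that `[ε_i(m), ε_j(n)] = m δ_ij δ_{m+n,0}`.
The value at `n = 0` is a placeholder. -/
def heis {N : ℕ} (i : Fin N) : ℤ → Module.End ℂ (Fock N)
  | Int.ofNat 0 => 0
  | Int.ofNat (n + 1) => ((n + 1 : ℕ) : ℂ) • (MvPolynomial.pderiv (i, n.succPNat)).toLinearMap
  | Int.negSucc n => LinearMap.mulLeft ℂ (MvPolynomial.X (i, n.succPNat))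

/-- The coefficient of `z^m` in `exp (x(z)) = ∑_k x(z)^k / k!`, for a formal power series `x(z)`
without constant term and with pairwise commuting coefficients (terms with `k > m` do not
contribute to `z^m`). -/
def expCoeff {A : Type*} [Ring A] [Algebra ℂ A] (x : PowerSeries A) (m : ℕ) : A :=
  ∑ k ∈ Finset.range (m + 1), ((k ! : ℂ)⁻¹) • PowerSeries.coeff m (x ^ k)

/-- `ε_i(n) - q^{(i-j)|n|} ε_j(n)`. -/
def osc {N : ℕ} (q : ℂ) (i j : Fin N) (n : ℤ) : Module.End ℂ (Fock N) :=
  heis i n - (q ^ ((((i : ℕ) : ℤ) - ((j : ℕ) : ℤ)) * |n|)) • heis j n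

/-- The exponent `∑_{n ≥ 1} (ε_i(-n) - q^{(i-j)n} ε_j(-n)) z^n / n`, a series in `z`. -/
def creationSeries {N : ℕ} (q : ℂ) (i j : Fin N) : PowerSeries (Module.End ℂ (Fock N)) :=
  PowerSeries.mk fun n => ((n : ℂ)⁻¹) • osc q i j (-(n : ℤ))

/-- The exponent `-∑_{n ≥ 1} (ε_i(n) - q^{(i-j)n} ε_j(n)) z^{-n} / n`, a series in `z⁻¹`. -/
def annihilationSeries {N : ℕ} (q : ℂ) (i j : Fin N) : PowerSeries (Module.End ℂ (Fock N)) :=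
  PowerSeries.mk fun n => (-(n : ℂ)⁻¹) • osc q i j (n : ℤ)

/-! Local nilpotency of the annihilation part: only finitely many coefficients of its exponential
act nontrivially on a given polynomial. -/

/-- Polynomials of degree at most `d`, where `ε_i(-n)` has degree `n`. -/
def degLE (N : ℕ) (d : ℤ) : Submodule ℂ (Fock N) :=
  MvPolynomial.restrictSupport ℂ
    {s | ((Finsupp.weight (fun p : Fin N × ℕ+ => (p.2 : ℕ)) s : ℕ) : ℤ) ≤ d}

lemma exists_mem_degLE {N : ℕ} (v : Fock N) : ∃ d : ℕ, v ∈ degLE N d := by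
  refine ⟨v.support.sup (Finsupp.weight (fun p : Fin N × ℕ+ => (p.2 : ℕ))), ?_⟩
  rw [degLE, MvPolynomial.mem_restrictSupport_iff]
  intro s hs
  simp only [Set.mem_ofPred_eq, Nat.cast_le]
  exact Finset.le_sup (f := Finsupp.weight (fun p : Fin N × ℕ+ => (p.2 : ℕ))) hs

lemma eq_zero_of_mem_degLE {N : ℕ} {d : ℤ} (hd : d < 0) {v : Fock N} (hv : v ∈ degLE N d) :
    v = 0 := by
  rw [degLE, MvPolynomial.mem_restrictSupport_iff] at hv
  rw [← MvPolynomial.support_eq_empty, Finset.eq_empty_iff_forall_notMem]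
  intro s hs
  have : ((Finsupp.weight (fun p : Fin N × ℕ+ => (p.2 : ℕ)) s : ℕ) : ℤ) ≤ d := hv hs
  omega

lemma pderiv_mem_degLE {N : ℕ} (p : Fin N × ℕ+) (d : ℤ) {v : Fock N} (hv : v ∈ degLE N d) :
    MvPolynomial.pderiv p v ∈ degLE N (d - (p.2 : ℕ)) := by
  rw [degLE, MvPolynomial.restrictSupport_eq_span] at hv
  induction hv using Submodule.span_induction with
  | mem x hx =>
    obtain ⟨s, hs, rfl⟩ := hx
    simp only [MvPolynomial.pderiv_monomial, one_mul]
    by_cases h0 : s p = 0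
    · simp [h0]
    · rw [degLE, MvPolynomial.monomial_mem_restrictSupport]
      left
      have := Finsupp.weight_sub_single_add (w := fun p : Fin N × ℕ+ => (p.2 : ℕ)) h0
      simp only [Set.mem_ofPred_eq] at hs ⊢
      omega
  | zero => simp
  | add x y _ _ hx hy => rw [map_add]; exact add_mem hx hy
  | smul a x _ hx => rw [Derivation.map_smul]; exact Submodule.smul_mem _ _ hx

lemma heis_mem_degLE {N : ℕ} (i : Fin N) (n : ℕ) (d : ℤ) {v : Fock N} (hv : v ∈ degLE N d) :
    heis i (n : ℤ) v ∈ degLE N (d - n) := by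
  cases n with
  | zero =>
    have h0 : heis i ((0 : ℕ) : ℤ) = 0 := rfl
    rw [h0]
    simp
  | succ n =>
    have h1 : heis i ((n + 1 : ℕ) : ℤ) v =
        ((n + 1 : ℕ) : ℂ) • MvPolynomial.pderiv (i, n.succPNat) v := rfl
    rw [h1]
    exact Submodule.smul_mem _ _ (pderiv_mem_degLE (i, n.succPNat) d hv)

lemma annihilationSeries_pow_mem {N : ℕ} (q : ℂ) (i j : Fin N) (k : ℕ) :
    ∀ (l : ℕ) (d : ℤ) (v : Fock N), v ∈ degLE N d →
      PowerSeries.coeff l (annihilationSeries q i j ^ k) v ∈ degLE N (d - l) := by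
  induction k with
  | zero =>
    intro l d v hv
    rw [pow_zero, PowerSeries.coeff_one]
    split_ifs with h
    · subst h; simpa using hv
    · simp
  | succ k ih =>
    intro l d v hv
    rw [pow_succ, PowerSeries.coeff_mul, LinearMap.sum_apply]
    refine Submodule.sum_mem _ fun x hx => ?_
    have hx' : x.1 + x.2 = l := by simpa using hx
    have h1 : PowerSeries.coeff x.2 (annihilationSeries q i j) v ∈ degLE N (d - x.2) := by
      simp only [annihilationSeries, PowerSeries.coeff_mk, osc, LinearMap.smul_apply,
        LinearMap.sub_apply]
      exact Submodule.smul_mem _ _ (sub_mem (heis_mem_degLE i _ d hv)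
        (Submodule.smul_mem _ _ (heis_mem_degLE j _ d hv)))
    have h2 := ih x.1 _ _ h1
    have h3 : d - (x.2 : ℤ) - x.1 = d - l := by omega
    rw [h3] at h2
    exact h2

lemma annihilation_finite {N : ℕ} (q : ℂ) (i j : Fin N) (v : Fock N) :
    {l : ℕ | expCoeff (annihilationSeries q i j) l v ≠ 0}.Finite := by
  obtain ⟨d, hd⟩ := exists_mem_degLE v
  refine (Set.finite_Iic d).subset fun l hl => ?_
  by_contra hlt
  apply hl
  have hneg : (d : ℤ) - l < 0 := by
    simp only [Set.mem_Iic, not_le] at hlt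
    omega
  apply eq_zero_of_mem_degLE hneg
  rw [expCoeff, LinearMap.sum_apply]
  exact Submodule.sum_mem _ fun k _ =>
    Submodule.smul_mem _ _ (annihilationSeries_pow_mem q i j k l d v hd)

/-- The `l`-th term of the coefficient of `z^s` in the normally ordered exponential below: the
coefficient of `z^{s+l}` in the creation part times that of `z^{-l}` in the annihilation part. -/
def normalOrderedTerm {N : ℕ} (q : ℂ) (i j : Fin N) (s : ℤ) (l : ℕ) : Module.End ℂ (Fock N) :=
  if 0 ≤ s + l then
    expCoeff (creationSeries q i j) (s + l).toNat * expCoeff (annihilationSeries q i j) l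
  else 0

lemma normalOrderedTerm_finite {N : ℕ} (q : ℂ) (i j : Fin N) (s : ℤ) (v : Fock N) :
    (Function.support fun l => normalOrderedTerm q i j s l v).Finite := by
  refine (annihilation_finite q i j v).subset fun l hl h0 => hl ?_
  simp only [normalOrderedTerm]
  split_ifs
  · rw [Module.End.mul_apply, h0, map_zero]
  · rfl

/-- The coefficient of `z^s` (`s ∈ ℤ`) in the normally ordered exponential
`:exp (-∑_{n ≠ 0} (ε_i(n) - q^{(i-j)|n|} ε_j(n)) z^{-n} / n):` as an operator on `S(H⁻)`.
Applied to a vector, the sum over `l` is finite. -/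
def normalOrderedExp {N : ℕ} (q : ℂ) (i j : Fin N) (s : ℤ) : Module.End ℂ (Fock N) where
  toFun v := ∑ᶠ l : ℕ, normalOrderedTerm q i j s l v
  map_add' v w := by
    simp only [map_add]
    exact finsum_add_distrib (normalOrderedTerm_finite q i j s v)
      (normalOrderedTerm_finite q i j s w)
  map_smul' a v := by
    simp only [map_smul, RingHom.id_apply]
    exact (smul_finsum a _).symm

/-! ### The space `V_Q` and the operators on it -/

/-- The group algebra `ℂ[Q]`, with basis `e^α`, `α ∈ Q`. -/
abbrev GroupAlg (N : ℕ) : Type := AddMonoidAlgebra ℂ (rootLattice N)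

/-- The basis element `e^α` of `ℂ[Q]`. -/
def ex {N : ℕ} (α : rootLattice N) : GroupAlg N := AddMonoidAlgebra.single α 1

/-- `V_Q = S(H⁻) ⊗ ℂ[Q]`. -/
abbrev VQ (N : ℕ) : Type := Fock N ⊗[ℂ] GroupAlg N

/-- The linear map on `ℂ[Q]` with prescribed values on the basis `e^α`. -/
def extend {N : ℕ} {M : Type*} [AddCommGroup M] [Module ℂ M] (f : rootLattice N → M) :
    GroupAlg N →ₗ[ℂ] M :=
  Finsupp.linearCombination ℂ f ∘ₗ (AddMonoidAlgebra.coeffLinearEquiv ℂ).toLinearMap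

/-- `e_β e^α = c(β, α) e^{α+β}`. -/
def latticeShift {N : ℕ} (c : rootLattice N → rootLattice N → ℤˣ) (β : rootLattice N) :
    Module.End ℂ (GroupAlg N) :=
  extend fun α => (((c β α : ℤˣ) : ℤ) : ℂ) • ex (α + β)

/-- `ε_i(n)` as an operator on `V_Q`. -/
def heisV {N : ℕ} (i : Fin N) (n : ℤ) : Module.End ℂ (VQ N) :=
  TensorProduct.map (heis i n) LinearMap.id

/-- The operator `μ^λ` on `V_Q`, for `λ ∈ P`: it sends `v ⊗ e^α` to `μ^{(λ, α)} v ⊗ e^α`. -/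
def powV {N : ℕ} (μ : ℂ) (lam : Fin N → ℤ) : Module.End ℂ (VQ N) :=
  TensorProduct.map LinearMap.id (extend fun α => (μ ^ (dotProduct lam α.1)) • ex α)

/-- The coefficient of `z^m` (`m ∈ ℤ`) of the vertex operator
`X_ij(z) = :exp (-∑_{n ≠ 0} (ε_i(n) - q^{(i-j)|n|} ε_j(n)) z^{-n} / n):
  e_β z^{β + (β, β)/2}`, with `β = ε_i - ε_j` and `z^β e^α = z^{(β, α)} e^α`.
On `v ⊗ e^α` the last factor gives `z^{(β, α) + (β, β)/2}`. -/
def vertexCoeff {N : ℕ} (q : ℂ) (c : rootLattice N → rootLattice N → ℤˣ) (i j : Fin N) (m : ℤ) :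
    Module.End ℂ (VQ N) :=
  TensorProduct.lift (LinearMap.flip (extend fun α =>
    (TensorProduct.mk ℂ (Fock N) (GroupAlg N)).flip (latticeShift c (root i j) (ex α)) ∘ₗ
      normalOrderedExp q i j
        (m - (dotProduct (root i j).1 α.1 + dotProduct (root i j).1 (root i j).1 / 2))))

/-- The algebra `ℬ` of operators on `V_Q` generated by the coefficients of `E_i(z) = X_{i,i+1}(z)`
and `F_i(z) = X_{i+1,i}(z)` for `1 ≤ i ≤ N - 1`, and by `ε_i(n)` and `q^{±ε_i}` for `1 ≤ i ≤ N` and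
`n ≠ 0`. -/
def algB {N : ℕ} (q : ℂ) (c : rootLattice N → rootLattice N → ℤˣ) :
    Subalgebra ℂ (Module.End ℂ (VQ N)) :=
  Algebra.adjoin ℂ
    ({T | ∃ i j : Fin N, (j : ℕ) = i + 1 ∧ ∃ m : ℤ, T = vertexCoeff q c i j m} ∪
     {T | ∃ i j : Fin N, (j : ℕ) = i + 1 ∧ ∃ m : ℤ, T = vertexCoeff q c j i m} ∪
     {T | ∃ (i : Fin N) (n : ℤ), n ≠ 0 ∧ T = heisV i n} ∪
     {T | ∃ i : Fin N, T = powV q (eps i) ∨ T = powV q (-eps i)})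

end FockRep

end

/-!
The space `V_Q` is the direct sum of the subspaces `S(H⁻) ⊗ e^α`, `α ∈ Q`, and a nonzero
`ℬ`-submodule is shown to be everything by moving inside and between these subspaces.

* The operators `q^{ε_i}` are diagonal, with eigenvalue `q^{α_i}` on `S(H⁻) ⊗ e^α`. As `q` is not a
  root of unity, these eigenvalues separate the elements of `Q`, so a nonzero submodule contains a
  nonzero vector `v ⊗ e^α` (`Submodule.exists_single_mem_of_diagonal`).
* A nonzero subspace of `S(H⁻)` stable under all partial derivatives and all multiplications by
  variables is the whole of `S(H⁻)`: differentiation lowers the degree until a nonzero constant is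
  reached (`MvPolynomial.submodule_eq_top_of_pderiv_of_X_mul`). Hence `S(H⁻) ⊗ e^α` lies in the
  submodule.
* The annihilation part of `X_ij(z)` fixes the vacuum `1`, so the lowest coefficient of
  `X_ij(z) (1 ⊗ e^α)` is `±1 ⊗ e^{α + ε_i - ε_j}` (`FockRep.vertexCoeff_vacuum`). Since the simple
  roots and their negatives generate `Q`, the submodule contains every `S(H⁻) ⊗ e^β`.
-/

/-! ### Stable subspaces of polynomial rings -/

namespace MvPolynomial

variable {σ K : Type*} [Field K] [CharZero K]

/-- A polynomial of positive degree over a field of characteristic zero has a nonzero partial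
derivative, and that derivative has smaller total degree. -/
lemma exists_pderiv_ne_zero_totalDegree_lt {p : MvPolynomial σ K} (hp : p.totalDegree ≠ 0) :
    ∃ i, pderiv i p ≠ 0 ∧ (pderiv i p).totalDegree < p.totalDegree := by
  classical
  obtain ⟨s, hs, i, hi⟩ : ∃ s ∈ p.support, ∃ i, s i ≠ 0 := by
    by_contra! h
    exact hp ((totalDegree_eq_zero_iff _ p).2 h)
  have hsi : s - Finsupp.single i 1 + Finsupp.single i 1 = s :=
    tsub_add_cancel_of_le (Finsupp.single_le_iff.2 (Nat.one_le_iff_ne_zero.2 hi))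
  refine ⟨i, fun h => ?_, ?_⟩
  · have hc := coeff_pderiv p (s - Finsupp.single i 1) (i := i)
    rw [h, coeff_zero, hsi] at hc
    exact mul_ne_zero (mem_support_iff.1 hs) (Nat.cast_add_one_ne_zero _) hc.symm
  · rw [totalDegree, Finset.sup_lt_iff (Nat.pos_of_ne_zero hp)]
    intro t ht
    have ht' : t + Finsupp.single i 1 ∈ p.support := by
      rw [mem_support_iff, coeff_pderiv] at ht
      exact mem_support_iff.2 (left_ne_zero_of_mul ht)
    have hle := le_totalDegree ht'
    rw [Finsupp.sum_add_index' (fun _ => rfl) (fun _ _ _ => rfl),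
      Finsupp.sum_single_index rfl] at hle
    omega

/-- In characteristic zero the polynomial ring is irreducible under the Weyl algebra. -/
lemma submodule_eq_top_of_pderiv_of_X_mul (U : Submodule K (MvPolynomial σ K))
    (hD : ∀ i, ∀ p ∈ U, pderiv i p ∈ U) (hX : ∀ i, ∀ p ∈ U, X i * p ∈ U) (hU : U ≠ ⊥) :
    U = ⊤ := by
  have hone : ∀ (d : ℕ) (p : MvPolynomial σ K), p.totalDegree = d → p ∈ U → p ≠ 0 → 1 ∈ U := by
    classical
    intro d
    induction d using Nat.strong_induction_on with
    | _ d ih =>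
      intro p hd hp hp0
      by_cases h : p.totalDegree = 0
      · rw [totalDegree_eq_zero_iff_eq_C] at h
        have hc : coeff 0 p ≠ 0 := fun hc => hp0 (by rw [h, hc, C_0])
        have := U.smul_mem (coeff 0 p)⁻¹ hp
        rwa [h, coeff_C, if_pos rfl, smul_eq_C_mul, ← C_mul, inv_mul_cancel₀ hc, C_1] at this
      · obtain ⟨i, hi, hlt⟩ := exists_pderiv_ne_zero_totalDegree_lt h
        exact ih _ (hd ▸ hlt) _ rfl (hD i p hp) hi
  obtain ⟨p, hp, hp0⟩ := U.ne_bot_iff.1 hU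
  have h1 : 1 ∈ U := hone _ p rfl hp hp0
  refine eq_top_iff.2 fun f _ => ?_
  induction f using MvPolynomial.induction_on with
  | C a => simpa [smul_eq_C_mul] using U.smul_mem a h1
  | add f g hf hg => exact add_mem (hf trivial) (hg trivial)
  | mul_X f i hf => rw [mul_comm]; exact hX i f (hf trivial)

end MvPolynomial

/-! ### Simultaneous eigenvectors of diagonal operators -/

/-- If a nonzero subspace of a direct sum of copies of `M` is stable under diagonal operators whose
eigenvalues `χ k a` separate the indices `a`, then it contains a nonzero vector of one summand. -/
lemma Submodule.exists_single_mem_of_diagonal {ι κ K M : Type*} [Field K] [AddCommGroup M]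
    [Module K M] (χ : κ → ι → K) (hχ : ∀ a b, (∀ k, χ k a = χ k b) → a = b)
    (U : Submodule K (ι →₀ M))
    (hU : ∀ k, ∀ f ∈ U, ∀ g : ι →₀ M, (∀ a, g a = χ k a • f a) → g ∈ U) (h0 : U ≠ ⊥) :
    ∃ (a : ι) (m : M), m ≠ 0 ∧ Finsupp.single a m ∈ U := by
  classical
  have key : ∀ (d : ℕ) (f : ι →₀ M), f.support.card = d → f ∈ U → f ≠ 0 →
      ∃ (a : ι) (m : M), m ≠ 0 ∧ Finsupp.single a m ∈ U := by
    intro d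
    induction d using Nat.strong_induction_on with
    | _ d ih =>
      intro f hd hf hf0
      obtain ⟨a, ha⟩ := Finsupp.support_nonempty_iff.2 hf0
      by_cases h : ∀ b ∈ f.support, b = a
      · refine ⟨a, f a, Finsupp.mem_support_iff.1 ha, ?_⟩
        rwa [← Finsupp.support_subset_singleton.1 fun b hb => Finset.mem_singleton.2 (h b hb)]
      · push Not at h
        obtain ⟨b, hb, hba⟩ := h
        obtain ⟨k, hk⟩ : ∃ k, χ k a ≠ χ k b := by
          by_contra! hk
          exact hba (hχ a b hk).symm
        let g : ι →₀ M := Finsupp.onFinset f.support (fun x => χ k x • f x) fun x hx =>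
          Finsupp.mem_support_iff.2 fun h => hx (by rw [h, smul_zero])
        -- subtracting the eigenvalue at `a` kills that component and keeps the one at `b`
        have hg : ∀ x, (g - χ k a • f) x = (χ k x - χ k a) • f x := fun x => by
          simp [g, sub_smul]
        refine ih _ ?_ (g - χ k a • f) rfl
          (U.sub_mem (hU k f hf g fun _ => rfl) (U.smul_mem _ hf)) fun h => ?_
        · rw [← hd]
          refine Finset.card_lt_card ((Finset.ssubset_iff_of_subset fun x hx => ?_).2 ⟨a, ha, ?_⟩)
          · rw [Finsupp.mem_support_iff, hg] at hx
            exact Finsupp.mem_support_iff.2 fun h => hx (by rw [h, smul_zero])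
          · rw [Finsupp.mem_support_iff, hg, sub_self, zero_smul, not_not]
        · have := hg b
          rw [h, Finsupp.zero_apply, eq_comm, smul_eq_zero, sub_eq_zero] at this
          exact this.elim (fun e => hk e.symm) (Finsupp.mem_support_iff.1 hb)
  obtain ⟨f, hf, hf0⟩ := U.ne_bot_iff.1 h0
  exact key _ f rfl hf hf0

namespace FockRep

variable {N : ℕ}

/-! ### The generating operators on pure tensors -/

lemma extend_ex {M : Type*} [AddCommGroup M] [Module ℂ M] (f : rootLattice N → M)
    (α : rootLattice N) : extend f (ex α) = f α := by
  simp [extend, ex]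

lemma powV_tmul_ex (μ : ℂ) (lam : Fin N → ℤ) (v : Fock N) (α : rootLattice N) :
    powV μ lam (v ⊗ₜ ex α) = μ ^ (lam ⬝ᵥ α.1) • (v ⊗ₜ[ℂ] ex α) := by
  rw [powV, TensorProduct.map_tmul, extend_ex, LinearMap.id_apply, TensorProduct.tmul_smul]

lemma vertexCoeff_tmul_ex (q : ℂ) (c : rootLattice N → rootLattice N → ℤˣ) (i j : Fin N) (m : ℤ)
    (v : Fock N) (α : rootLattice N) :
    vertexCoeff q c i j m (v ⊗ₜ ex α) =
      (((c (root i j) α : ℤˣ) : ℤ) : ℂ) • (normalOrderedExp q i j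
        (m - (dotProduct (root i j).1 α.1 + dotProduct (root i j).1 (root i j).1 / 2)) v
          ⊗ₜ[ℂ] ex (α + root i j)) := by
  rw [vertexCoeff, TensorProduct.lift.tmul, LinearMap.flip_apply, extend_ex, latticeShift,
    extend_ex]
  simp

/-- Differentiation lowers the degree, so the constant `1` is killed by every coefficient of
positive index in the exponential of the annihilation part. -/
lemma expCoeff_annihilationSeries_one (q : ℂ) (i j : Fin N) {l : ℕ} (hl : 0 < l) :
    expCoeff (annihilationSeries q i j) l 1 = 0 := by
  have h1 : (1 : Fock N) ∈ degLE N 0 := by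
    rw [← MvPolynomial.C_1, ← MvPolynomial.monomial_zero', degLE,
      MvPolynomial.monomial_mem_restrictSupport]
    left
    simp
  refine eq_zero_of_mem_degLE (d := 0 - l) (by omega) ?_
  rw [expCoeff, LinearMap.sum_apply]
  exact Submodule.sum_mem _ fun k _ =>
    Submodule.smul_mem _ _ (annihilationSeries_pow_mem q i j k l 0 1 h1)

lemma expCoeff_zero {A : Type*} [Ring A] [Algebra ℂ A] (x : PowerSeries A) : expCoeff x 0 = 1 := by
  simp [expCoeff]

lemma normalOrderedExp_zero_one (q : ℂ) (i j : Fin N) : normalOrderedExp q i j 0 1 = 1 := by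
  change ∑ᶠ l : ℕ, normalOrderedTerm q i j 0 l 1 = 1
  rw [finsum_eq_single _ 0]
  · simp [normalOrderedTerm, expCoeff_zero]
  · intro l hl
    rw [normalOrderedTerm, if_pos (by omega), Module.End.mul_apply,
      expCoeff_annihilationSeries_one q i j (Nat.pos_of_ne_zero hl), map_zero]

/-- The lowest coefficient of `X_ij(z) (1 ⊗ e^α)`, at `z^{(β, α) + (β, β)/2}` for `β = ε_i - ε_j`. -/
lemma vertexCoeff_vacuum (q : ℂ) (c : rootLattice N → rootLattice N → ℤˣ) (i j : Fin N)
    (α : rootLattice N) :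
    vertexCoeff q c i j
        (dotProduct (root i j).1 α.1 + dotProduct (root i j).1 (root i j).1 / 2) (1 ⊗ₜ ex α) =
      (((c (root i j) α : ℤˣ) : ℤ) : ℂ) • ((1 : Fock N) ⊗ₜ[ℂ] ex (α + root i j)) := by
  rw [vertexCoeff_tmul_ex, sub_self, normalOrderedExp_zero_one]

lemma heis_succ (i : Fin N) (n : ℕ+) (v : Fock N) :
    heis i (n : ℕ) v = ((n : ℕ) : ℂ) • MvPolynomial.pderiv (i, n) v := by
  obtain ⟨k, rfl⟩ : ∃ k : ℕ, n = k.succPNat := ⟨n.natPred, (PNat.succPNat_natPred n).symm⟩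
  rfl

lemma heis_neg (i : Fin N) (n : ℕ+) (v : Fock N) :
    heis i (-((n : ℕ) : ℤ)) v = MvPolynomial.X (i, n) * v := by
  obtain ⟨k, rfl⟩ : ∃ k : ℕ, n = k.succPNat := ⟨n.natPred, (PNat.succPNat_natPred n).symm⟩
  rfl

/-! ### Submodules of `V_Q` -/

lemma zpow_injective_of_pow_ne_one {q : ℂ} (hq0 : q ≠ 0) (hq : ∀ n : ℕ, 0 < n → q ^ n ≠ 1) :
    Function.Injective fun n : ℤ => q ^ n := by
  have h : ¬ IsOfFinOrder (Units.mk0 q hq0) := by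
    rw [isOfFinOrder_iff_pow_eq_one]
    rintro ⟨n, hn, h⟩
    exact hq n hn (by simpa using congrArg Units.val h)
  intro a b hab
  refine injective_zpow_iff_not_isOfFinOrder.2 h (Units.ext ?_)
  simpa using hab

section Submodules

variable {q : ℂ} {c : rootLattice N → rootLattice N → ℤˣ} (W : Submodule (algB q c) (VQ N))

lemma apply_mem_of_mem_algB {T : Module.End ℂ (VQ N)} (hT : T ∈ algB q c) {w : VQ N} (hw : w ∈ W) :
    T w ∈ W :=
  W.smul_mem ⟨T, hT⟩ hw

/-- The subspace of all `v ∈ S(H⁻)` with `v ⊗ e^α ∈ W`. -/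
noncomputable def slice (α : rootLattice N) : Submodule ℂ (Fock N) :=
  (W.restrictScalars ℂ).comap ((TensorProduct.mk ℂ (Fock N) (GroupAlg N)).flip (ex α))

lemma mem_slice {α : rootLattice N} {v : Fock N} : v ∈ slice W α ↔ v ⊗ₜ ex α ∈ W := Iff.rfl

lemma heis_mem_slice {α : rootLattice N} {v : Fock N} (hv : v ∈ slice W α) (i : Fin N) {n : ℤ}
    (hn : n ≠ 0) : heis i n v ∈ slice W α := by
  have hT : heisV i n ∈ algB q c := Algebra.subset_adjoin (Or.inl (Or.inr ⟨i, n, hn, rfl⟩))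
  exact apply_mem_of_mem_algB W hT hv

lemma slice_eq_top_of_ne_bot {α : rootLattice N} (h : slice W α ≠ ⊥) : slice W α = ⊤ := by
  refine MvPolynomial.submodule_eq_top_of_pderiv_of_X_mul _ ?_ ?_ h
  · rintro ⟨i, n⟩ p hp
    have hn : ((n : ℕ) : ℂ) ≠ 0 := by exact_mod_cast n.ne_zero
    have := heis_mem_slice W hp i (n := (n : ℕ)) (by exact_mod_cast n.ne_zero)
    rw [heis_succ] at this
    exact ((slice W α).smul_mem_iff hn).1 this
  · rintro ⟨i, n⟩ p hp
    have := heis_mem_slice W hp i (n := -((n : ℕ) : ℤ))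
      (neg_ne_zero.2 (by exact_mod_cast n.ne_zero))
    rwa [heis_neg] at this

lemma slice_add_root_eq_top {α : rootLattice N} (h : slice W α = ⊤) {i j : Fin N}
    (hij : (j : ℕ) = i + 1 ∨ (i : ℕ) = j + 1) : slice W (α + root i j) = ⊤ := by
  refine slice_eq_top_of_ne_bot W ((Submodule.ne_bot_iff _).2 ⟨1, ?_, one_ne_zero⟩)
  have hT : ∀ m, vertexCoeff q c i j m ∈ algB q c := fun m => Algebra.subset_adjoin <|
    hij.elim (fun h => Or.inl (Or.inl (Or.inl ⟨i, j, h, m, rfl⟩)))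
      (fun h => Or.inl (Or.inl (Or.inr ⟨j, i, h, m, rfl⟩)))
  have h1 : (1 : Fock N) ∈ slice W α := h ▸ Submodule.mem_top
  have h2 := apply_mem_of_mem_algB W (hT (dotProduct (root i j).1 α.1 +
    dotProduct (root i j).1 (root i j).1 / 2)) ((mem_slice W).1 h1)
  rw [vertexCoeff_vacuum] at h2
  have hc : (((c (root i j) α : ℤˣ) : ℤ) : ℂ) ≠ 0 := by
    exact_mod_cast (c (root i j) α).ne_zero
  exact ((W.restrictScalars ℂ).smul_mem_iff hc).1 h2

lemma root_swap (i j : Fin N) : root j i = -root i j :=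
  Subtype.ext (neg_sub (eps i) (eps j)).symm

lemma slice_eq_top {α : rootLattice N} (h : slice W α = ⊤) (β : rootLattice N) :
    slice W β = ⊤ := by
  -- translations of `Q` by elements of the generated subgroup preserve the set of full slices
  have key : ∀ x (hx : x ∈ rootLattice N) (γ : rootLattice N),
      slice W γ = ⊤ → slice W (γ + ⟨x, hx⟩) = ⊤ := by
    intro x hx
    induction hx using AddSubgroup.closure_induction'' with
    | mem x hx =>
      obtain ⟨i, j, hij, rfl⟩ := hx
      exact fun γ hγ => slice_add_root_eq_top W hγ (Or.inl hij)
    | neg_mem x hx =>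
      obtain ⟨i, j, hij, rfl⟩ := hx
      intro γ hγ
      have := slice_add_root_eq_top W hγ (Or.inr hij : (i : ℕ) = j + 1 ∨ (j : ℕ) = i + 1)
      rwa [root_swap] at this
    | zero => exact fun γ hγ => (add_zero γ).symm ▸ hγ
    | add x y hx hy ihx ihy =>
      intro γ hγ
      have := ihy _ (ihx γ hγ)
      rwa [add_assoc] at this
  exact add_sub_cancel α β ▸ key (β - α).1 (β - α).2 α h

lemma exists_slice_ne_bot (hq0 : q ≠ 0) (hq : ∀ n : ℕ, 0 < n → q ^ n ≠ 1) (hW : W ≠ ⊥) :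
    ∃ α, slice W α ≠ ⊥ := by
  classical
  let Φ : VQ N ≃ₗ[ℂ] (rootLattice N →₀ Fock N) :=
    TensorProduct.equivFinsuppOfBasisRight (AddMonoidAlgebra.basis (rootLattice N) ℂ)
  have hΦ : ∀ α v, Φ.symm (Finsupp.single α v) = v ⊗ₜ ex α := fun α v => by
    simp [Φ, ex]
  -- in components, `q^{ε_i}` is multiplication by the scalars `q^{α_i}`
  have hpow : ∀ (i : Fin N) (g : rootLattice N →₀ Fock N) (α : rootLattice N),
      Φ (powV q (eps i) (Φ.symm g)) α = q ^ (α.1 i) • g α := by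
    intro i g α
    induction g using Finsupp.induction_linear with
    | zero => simp
    | add f g hf hg => simp only [map_add, Finsupp.add_apply, hf, hg, smul_add]
    | single β v =>
      rw [hΦ, powV_tmul_ex, map_smul, ← hΦ, LinearEquiv.apply_symm_apply, Finsupp.smul_apply,
        eps, single_dotProduct, one_mul]
      by_cases hβ : β = α
      · rw [hβ]
      · rw [Finsupp.single_eq_of_ne' hβ, smul_zero, smul_zero]
  obtain ⟨w, hw, hw0⟩ := W.ne_bot_iff.1 hW
  obtain ⟨α, v, hv, hmem⟩ := Submodule.exists_single_mem_of_diagonal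
    (fun (i : Fin N) (α : rootLattice N) => q ^ (α.1 i))
    (fun α β h => Subtype.ext (funext fun i => zpow_injective_of_pow_ne_one hq0 hq (h i)))
    ((W.restrictScalars ℂ).comap Φ.symm.toLinearMap)
    (fun i f hf g hg => by
      have hT : powV q (eps i) ∈ algB q c := Algebra.subset_adjoin (Or.inr ⟨i, Or.inl rfl⟩)
      have h1 : g = Φ (powV q (eps i) (Φ.symm f)) := by
        ext1 α
        rw [hg, hpow]
      have h2 : Φ.symm g = powV q (eps i) (Φ.symm f) := by
        rw [h1, LinearEquiv.symm_apply_apply]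
      change Φ.symm g ∈ W
      rw [h2]
      exact apply_mem_of_mem_algB W hT hf)
    ((Submodule.ne_bot_iff _).2 ⟨Φ w, by
      change Φ.symm (Φ w) ∈ W
      rwa [LinearEquiv.symm_apply_apply], by simpa using hw0⟩)
  refine ⟨α, (Submodule.ne_bot_iff _).2 ⟨v, ?_, hv⟩⟩
  rw [mem_slice, ← hΦ]
  exact hmem

lemma eq_top_of_slice_eq_top (h : ∀ α, slice W α = ⊤) : W = ⊤ := by
  refine (Submodule.eq_top_iff').2 fun w => ?_
  induction w using TensorProduct.induction_on with
  | zero => exact W.zero_mem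
  | add x y hx hy => exact W.add_mem hx hy
  | tmul v g =>
    induction (AddMonoidAlgebra.basis (rootLattice N) ℂ).mem_span g using
      Submodule.span_induction with
    | mem x hx =>
      obtain ⟨α, rfl⟩ := hx
      exact (mem_slice W).1 (h α ▸ Submodule.mem_top)
    | zero => rw [TensorProduct.tmul_zero]; exact W.zero_mem
    | add x y _ _ hx hy => rw [TensorProduct.tmul_add]; exact W.add_mem hx hy
    | smul a x _ hx =>
      rw [TensorProduct.tmul_smul]
      exact (W.restrictScalars ℂ).smul_mem a hx

end Submodules

end FockRep

theorem proposition3p18 (N : ℕ) (hN : 3 ≤ N) (q : ℂ) (hq0 : q ≠ 0)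
    (hq : ∀ n : ℕ, 0 < n → q ^ n ≠ 1)
    (c : FockRep.rootLattice N → FockRep.rootLattice N → ℤˣ) (hc : FockRep.IsSignCocycle c) :
    IsSimpleOrder (Submodule (FockRep.algB q c) (FockRep.VQ N)) := by
  have : Nontrivial (FockRep.VQ N) :=
    (TensorProduct.equivFinsuppOfBasisRight (M := FockRep.Fock N)
      (AddMonoidAlgebra.basis (FockRep.rootLattice N) ℂ)).toEquiv.nontrivial
  refine IsSimpleOrder.of_forall_eq_top fun W hW => ?_
  obtain ⟨α, hα⟩ := FockRep.exists_slice_ne_bot W hq0 hq hW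
  exact FockRep.eq_top_of_slice_eq_top W
    (FockRep.slice_eq_top W (FockRep.slice_eq_top_of_ne_bot W hα))
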